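/- A multigraph here is finite and connected, and loops and parallel edges are allowed; $\kappa_X$ denotes the number of spanning trees of a multigraph $X$. Covering maps of multigraphs are covering maps of one-dimensional CW complexes, that is, morphisms of multigraphs that map, for each vertex $w$, the oriented edges starting at $w$ bijectively onto the oriented edges starting at the image of $w$ (each edge, also each loop, has two orientations). **Theorem.** Let $\pi\colon Y\to X$ be a Galois covering of multigraphs (i.e. a covering whose automorphism group $\mathrm{Aut}(Y/X)$ acts transitively on each fibre) with $\mathrm{Aut}(Y/X)\simeq \mathbb{Z}/2\mathbb{Z}\times\mathbb{Z}/2\mathbb{Z}$. Let $X_2,X_3,X_4$ be the intermediate double covers of $X$, i.e. three pairwise inequivalent multigraphs $X_i$ given with covering maps $Y\to X_i\to X$ whose composite is $\pi$, with $X_i\to X$ of degree two (two of them are equivalent if they are isomorphic compatibly with the maps from $Y$ and to $X$). Then $$\kappa_Y = 2\cdot\frac{\kappa_{X_2}\,\kappa_{X_3}\,\kappa_{X_4}}{\kappa_X^{2}}.$$ -/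

import Mathlib

/-- A multigraph with vertex type `V`, given through its oriented edges `D`. Every edge (also every
loop) has exactly two orientations `d` and `inv d`; the edges are the pairs `{d, inv d}`, and the
edge of `d` has the endpoints `src d` and `src (inv d)`. Loops and parallel edges are allowed.
Finiteness and connectedness are separate hypotheses. -/
@[ext]
structure Multigraph (V D : Type*) where
  /-- The initial vertex of an oriented edge. -/
  src : D → V
  /-- The same edge with the opposite orientation. -/
  inv : D → D
  inv_inv : ∀ d, inv (inv d) = d
  inv_ne : ∀ d, inv d ≠ d

namespace Multigraph

section

variable {V D V' D' V'' D'' : Type*}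

/-- The terminal vertex of an oriented edge. -/
def tgt (X : Multigraph V D) (d : D) : V := X.src (X.inv d)

/-- A multigraph is connected if it is nonempty and any two of its vertices are joined by a path,
that is, by a sequence of successive oriented edges. -/
def IsConnected (X : Multigraph V D) : Prop :=
  Nonempty V ∧
    ∀ v w, Relation.ReflTransGen (fun a b => ∃ d, X.src d = a ∧ X.tgt d = b) v w

/-- A cycle of length `m + 1`: a closed path `c 0, ..., c m` (the index `i + 1` is cyclic) in which
no edge is repeated, in either orientation, and whose terminal vertices are distinct. -/
def IsCycle (X : Multigraph V D) {m : ℕ} (c : Fin (m + 1) → D) : Prop :=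
  (∀ i, X.tgt (c i) = X.src (c (i + 1))) ∧
    (∀ i j, i ≠ j → c i ≠ c j ∧ c i ≠ X.inv (c j)) ∧
    ∀ i j, i ≠ j → X.tgt (c i) ≠ X.tgt (c j)

/-- A multigraph without cycles. -/
def IsAcyclic (X : Multigraph V D) : Prop :=
  ∀ (m : ℕ) (c : Fin (m + 1) → D), ¬ X.IsCycle c

/-- A subgraph: a set of vertices and a set of edges (a set of oriented edges closed under
inversion) whose endpoints are among these vertices. -/
@[ext]
structure Subgraph (X : Multigraph V D) where
  verts : Set V
  darts : Set D
  inv_mem : ∀ d ∈ darts, X.inv d ∈ darts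
  src_mem : ∀ d ∈ darts, X.src d ∈ verts

/-- A subgraph as a multigraph in its own right. -/
def Subgraph.toMultigraph {X : Multigraph V D} (H : X.Subgraph) :
    Multigraph H.verts H.darts where
  src d := ⟨X.src d, H.src_mem d d.2⟩
  inv d := ⟨X.inv d, H.inv_mem d d.2⟩
  inv_inv d := Subtype.ext (X.inv_inv d)
  inv_ne d h := X.inv_ne d (congrArg Subtype.val h)

/-- A spanning tree: a connected subgraph that contains all vertices and no cycles. -/
def Subgraph.IsSpanningTree {X : Multigraph V D} (H : X.Subgraph) : Prop :=
  H.verts = Set.univ ∧ H.toMultigraph.IsConnected ∧ H.toMultigraph.IsAcyclic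

/-- The number of spanning trees. -/
noncomputable def kappa (X : Multigraph V D) : ℕ :=
  Nat.card {H : X.Subgraph // H.IsSpanningTree}

/-- A morphism of multigraphs, given on vertices and on oriented edges. -/
@[ext]
structure Hom (Y : Multigraph V' D') (X : Multigraph V D) where
  onV : V' → V
  onD : D' → D
  src_onD : ∀ d, X.src (onD d) = onV (Y.src d)
  inv_onD : ∀ d, X.inv (onD d) = onD (Y.inv d)

/-- Composition of morphisms: first `g`, then `f`. -/
def Hom.comp {Z : Multigraph V'' D''} {Y : Multigraph V' D'} {X : Multigraph V D}
    (f : Hom Y X) (g : Hom Z Y) : Hom Z X where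
  onV := f.onV ∘ g.onV
  onD := f.onD ∘ g.onD
  src_onD d := by simp [f.src_onD, g.src_onD]
  inv_onD d := by simp [f.inv_onD, g.inv_onD]

/-- A covering map of multigraphs: at each vertex `w` of `Y` the oriented edges starting at `w` are
mapped bijectively onto the oriented edges starting at the image of `w`. (Between connected
multigraphs such a map is surjective.) -/
def Hom.IsCovering {Y : Multigraph V' D'} {X : Multigraph V D} (f : Hom Y X) : Prop :=
  ∀ w : V', Set.BijOn f.onD {d | Y.src d = w} {d | X.src d = f.onV w}

/-- A covering map is of degree `n` if every fibre has `n` elements. -/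
def Hom.HasDegree {Y : Multigraph V' D'} {X : Multigraph V D} (f : Hom Y X) (n : ℕ) : Prop :=
  ∀ v : V, Nat.card {w : V' // f.onV w = v} = n

/-- The group `Aut(Y/X)` of covering automorphisms: the automorphisms of `Y` (permutations of the
vertices and of the oriented edges compatible with the structure) that commute with the projection
to `X`. -/
def Hom.deck {Y : Multigraph V' D'} {X : Multigraph V D} (f : Hom Y X) :
    Subgroup (Equiv.Perm V' × Equiv.Perm D') where
  carrier := {σ | (∀ d, Y.src (σ.2 d) = σ.1 (Y.src d)) ∧ (∀ d, Y.inv (σ.2 d) = σ.2 (Y.inv d)) ∧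
    (∀ w, f.onV (σ.1 w) = f.onV w) ∧ ∀ d, f.onD (σ.2 d) = f.onD d}
  one_mem' := by simp
  mul_mem' := by
    rintro σ τ ⟨h1, h2, h3, h4⟩ ⟨k1, k2, k3, k4⟩
    simp [*]
  inv_mem' := by
    rintro σ ⟨h1, h2, h3, h4⟩
    refine ⟨fun d => ?_, fun d => ?_, fun w => ?_, fun d => ?_⟩
    · apply σ.1.injective
      simp [← h1]
    · apply σ.2.injective
      simp [← h2]
    · simpa using (h3 (σ⁻¹.1 w)).symm
    · simpa using (h4 (σ⁻¹.2 d)).symm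

/-- A covering map is Galois (or regular) if its automorphism group acts transitively on each
fibre. -/
def Hom.IsGalois {Y : Multigraph V' D'} {X : Multigraph V D} (f : Hom Y X) : Prop :=
  f.IsCovering ∧ ∀ w w', f.onV w = f.onV w' → ∃ σ ∈ f.deck, σ.1 w = w'

end

/-- An intermediate double cover of `π : Y → X`: a finite connected multigraph with covering maps
`Y → graph → X` whose composite is `π` and the second of which has degree two. -/
structure IntermediateDoubleCover.{u, v, u₁, v₁, u₂, v₂} {V' : Type u₁} {D' : Type v₁}
    {V : Type u₂} {D : Type v₂} {Y : Multigraph V' D'} {X : Multigraph V D} (π : Hom Y X) where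
  V₁ : Type u
  D₁ : Type v
  graph : Multigraph V₁ D₁
  finite_V : Finite V₁
  finite_D : Finite D₁
  connected : graph.IsConnected
  fromTop : Hom Y graph
  toBase : Hom graph X
  fromTop_covering : fromTop.IsCovering
  toBase_covering : toBase.IsCovering
  toBase_degree : toBase.HasDegree 2
  comp_eq : toBase.comp fromTop = π

/-- Two intermediate double covers are equivalent if they are isomorphic by an isomorphism of
multigraphs that is compatible with the maps from `Y` and to `X`. -/
def IntermediateDoubleCover.Equivalent {V' D' V D : Type*} {Y : Multigraph V' D'}
    {X : Multigraph V D} {π : Hom Y X} (A B : IntermediateDoubleCover π) : Prop :=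
  ∃ φ : Hom A.graph B.graph, φ.onV.Bijective ∧ φ.onD.Bijective ∧
    φ.comp A.fromTop = B.fromTop ∧ B.toBase.comp φ = A.toBase

end Multigraph

open Matrix

/-! Spanning trees enter through the Laplacian `L`, whose cofactors all equal the number of spanning
trees (matrix-tree theorem). With `J` the all-ones matrix and `n` the number of vertices, this
becomes `det (L + c J) = c n² κ` (`det_lap_add_const`), a form that behaves well under coverings.

A set-theoretic section of the covering identifies the vertices of `Y` with (Klein four-group) ×
(vertices of `X`). Deck invariance makes `L_Y` block circulant, with blocks `B_k`, so that `det (L_Y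
+ J)` is a product over the four characters. The trivial character gives `det (L_X + 4 J)`; for a
nontrivial character `χ` the `J`-part cancels and the factor is `d_χ = det (∑ χ(k) B_k)`, with signs
`χ(k) = ±1`. Hence `4 κ_Y = κ_X d₂ d₃ d₄` (`kappa_top`).

A double cover `X_i` determines a character whose kernel fixes the map to `X_i`, and the same
computation gives `2 κ_{X_i} = κ_X d_i` (`kappa_intermediate`). Inequivalent covers have distinct
characters, so all three nontrivial characters occur. Multiplying the relations eliminates the
`d_i`. -/

/-- If every element is related to `r` by a chain, there is a rank function that vanishes only
at `r` and that can be decreased along the relation away from `r`. -/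
theorem exists_rank_of_reflTransGen {V : Type*} (R : V → V → Prop) (r : V)
    (h : ∀ v, Relation.ReflTransGen R v r) :
    ∃ rk : V → ℕ, ∀ v, v ≠ r → ∃ w, R v w ∧ rk w < rk v := by
  classical
  -- `B n` is the set of elements that reach `r` in at most `n` steps; the rank is the distance to
  -- `r`.
  let B : ℕ → Set V := fun n =>
    Nat.rec (motive := fun _ => Set V) {r} (fun _ S => {v | v ∈ S ∨ ∃ w ∈ S, R v w}) n
  have hB : ∀ v, ∃ n, v ∈ B n := fun v => by
    induction h v using Relation.ReflTransGen.head_induction_on with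
    | refl => exact ⟨0, rfl⟩
    | head hab _ ih =>
      obtain ⟨n, hn⟩ := ih
      exact ⟨n + 1, Or.inr ⟨_, hn, hab⟩⟩
  refine ⟨fun v => Nat.find (hB v), fun v hv => ?_⟩
  have hspec := Nat.find_spec (hB v)
  rcases hn : Nat.find (hB v) with _ | n
  · rw [hn] at hspec
    exact absurd hspec hv
  · rw [hn] at hspec
    have hnot : v ∉ B n := Nat.find_min (hB v) (by omega)
    obtain h1 | ⟨w, hw, hvw⟩ := hspec
    · exact absurd h1 hnot
    · refine ⟨w, hvw, ?_⟩
      have hw' := Nat.find_min' (hB w) hw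
      dsimp only
      omega

/-! ### Spanning trees as rooted arborescences -/

namespace Multigraph

variable {V D : Type*} (X : Multigraph V D)

theorem tgt_inv (d : D) : X.tgt (X.inv d) = X.src d := by simp [tgt, X.inv_inv]

theorem src_inv (d : D) : X.src (X.inv d) = X.tgt d := rfl

/-- Adjacency through a dart of the set `S`. -/
def StepIn (S : Set D) (a b : V) : Prop := ∃ d ∈ S, X.src d = a ∧ X.tgt d = b

/-- A rooted spanning arborescence with root `r`: every vertex but the root chooses an outgoing
dart, so that following these darts leads to the root. -/
structure IsArborescence (r : V) (f : V → Option D) : Prop where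
  eq_none_iff : ∀ v, f v = none ↔ v = r
  src_eq : ∀ v d, f v = some d → X.src d = v
  exists_rank : ∃ rk : V → ℕ, ∀ v d, f v = some d → rk (X.tgt d) < rk v

/-- The darts of an arborescence, in both orientations. -/
def arborescenceDarts (f : V → Option D) : Set D :=
  {d | ∃ v, f v = some d ∨ f v = some (X.inv d)}

variable {X}

theorem inv_mem_arborescenceDarts {f : V → Option D} {d : D} (h : d ∈ X.arborescenceDarts f) :
    X.inv d ∈ X.arborescenceDarts f := by
  obtain ⟨v, h | h⟩ := h
  · exact ⟨v, Or.inr (by rwa [X.inv_inv])⟩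
  · exact ⟨v, Or.inl h⟩

theorem exists_isArborescence {S : Set D} {r : V}
    (h : ∀ v, Relation.ReflTransGen (X.StepIn S) v r) :
    ∃ f, X.IsArborescence r f ∧ ∀ v d, f v = some d → d ∈ S := by
  classical
  obtain ⟨rk, hrk⟩ := exists_rank_of_reflTransGen _ r h
  have : ∀ v, v ≠ r → ∃ d ∈ S, X.src d = v ∧ rk (X.tgt d) < rk v := by
    intro v hv
    obtain ⟨w, ⟨d, hd, h1, h2⟩, h3⟩ := hrk v hv
    exact ⟨d, hd, h1, h2 ▸ h3⟩
  choose g hg using this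
  have key : ∀ v d, (if h : v = r then none else some (g v h)) = some d → ∃ h, g v h = d := by
    intro v d h
    split_ifs at h with h1
    exact ⟨h1, Option.some.inj h⟩
  refine ⟨fun v => if h : v = r then none else some (g v h), ⟨fun v => by simp, ?_, rk, ?_⟩, ?_⟩
  · intro v d h
    obtain ⟨h1, rfl⟩ := key v d h
    exact (hg v h1).2.1
  · intro v d h
    obtain ⟨h1, rfl⟩ := key v d h
    exact (hg v h1).2.2
  · intro v d h
    obtain ⟨h1, rfl⟩ := key v d h
    exact (hg v h1).1

theorem reflTransGen_symm {S : Set D} (hS : ∀ d ∈ S, X.inv d ∈ S) {a b : V}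
    (h : Relation.ReflTransGen (X.StepIn S) a b) : Relation.ReflTransGen (X.StepIn S) b a := by
  induction h with
  | refl => exact .refl
  | tail _ hbc ih =>
    obtain ⟨d, hd, h1, h2⟩ := hbc
    exact .head ⟨X.inv d, hS d hd, h2, (X.tgt_inv d).trans h1⟩ ih

theorem IsArborescence.reflTransGen {r : V} {f : V → Option D} (hf : X.IsArborescence r f)
    (v : V) : Relation.ReflTransGen (X.StepIn (X.arborescenceDarts f)) v r := by
  obtain ⟨rk, hrk⟩ := hf.exists_rank
  induction hn : rk v using Nat.strong_induction_on generalizing v with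
  | _ n ih =>
    rcases hv : f v with _ | d
    · rw [(hf.eq_none_iff v).1 hv]
    · subst hn
      exact .head ⟨d, ⟨v, Or.inl hv⟩, hf.src_eq v d hv, rfl⟩ (ih _ (hrk v d hv) _ rfl)

theorem IsArborescence.reflTransGen_any {r : V} {f : V → Option D} (hf : X.IsArborescence r f)
    (v w : V) : Relation.ReflTransGen (X.StepIn (X.arborescenceDarts f)) v w :=
  (hf.reflTransGen v).trans
    (reflTransGen_symm (fun _ => inv_mem_arborescenceDarts) (hf.reflTransGen w))

/-- An arborescence is determined by its darts. -/
theorem IsArborescence.eq_of_darts_eq {r : V} {f g : V → Option D} (hf : X.IsArborescence r f)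
    (hg : X.IsArborescence r g) (h : X.arborescenceDarts f = X.arborescenceDarts g) : f = g := by
  obtain ⟨rk, hrk⟩ := hf.exists_rank
  funext v
  induction hn : rk v using Nat.strong_induction_on generalizing v with
  | _ n ih =>
    subst hn
    rcases hv : f v with _ | d
    · exact ((hg.eq_none_iff v).2 ((hf.eq_none_iff v).1 hv)).symm
    · have hd : d ∈ X.arborescenceDarts g := h ▸ ⟨v, Or.inl hv⟩
      obtain ⟨u, hu | hu⟩ := hd
      · have : u = v := (hg.src_eq u d hu).symm.trans (hf.src_eq v d hv)
        rw [← this, hu]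
      -- Here `g` would use the edge of `d` backwards, from `u = X.tgt d`. By induction `f` makes
      -- the same choice at `u`, and the rank would drop both from `v` to `u` and from `u` to `v`.
      · have hut : u = X.tgt d := (hg.src_eq u _ hu).symm
        have h1 := hrk v d hv
        rw [← hut] at h1
        have h2 := ih (rk u) h1 u rfl
        have h3 := hrk u _ (h2.trans hu)
        rw [tgt_inv, hf.src_eq v d hv] at h3
        omega

/-- An arborescence contains no cycle. -/
theorem IsArborescence.not_isCycle {r : V} {f : V → Option D} (hf : X.IsArborescence r f) {m : ℕ}
    (c : Fin (m + 1) → D) (hc : ∀ i, c i ∈ X.arborescenceDarts f) : ¬ X.IsCycle c := by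
  rintro ⟨h1, h2, -⟩
  obtain ⟨rk, hrk⟩ := hf.exists_rank
  -- At a vertex of maximal rank on the cycle, the next dart and the reverse of the current one both
  -- start there without raising the rank. Both are therefore the choice of `f`, and the cycle
  -- backtracks.
  obtain ⟨i, hi⟩ := Finite.exists_max fun i => rk (X.tgt (c i))
  have down : ∀ d ∈ X.arborescenceDarts f, rk (X.tgt d) ≤ rk (X.src d) →
      f (X.src d) = some d := by
    rintro d ⟨v, hv | hv⟩ hd
    · rwa [hf.src_eq v d hv]
    · have h3 := hrk v _ hv
      rw [tgt_inv, ← hf.src_eq v _ hv, src_inv] at h3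
      omega
  have e1 := down _ (hc (i + 1)) (by rw [← h1 i]; exact hi _)
  have e2 := down (X.inv (c i)) (inv_mem_arborescenceDarts (hc i)) (by
    rw [tgt_inv, src_inv]
    have := hi (i - 1)
    rwa [h1 (i - 1), sub_add_cancel] at this)
  rw [← h1 i] at e1
  rw [src_inv] at e2
  have e3 : c (i + 1) = X.inv (c i) := Option.some.inj (e1.symm.trans e2)
  by_cases hne : i + 1 = i
  · rw [hne] at e3
    exact X.inv_ne _ e3.symm
  · exact (h2 _ _ hne).2 e3

/-- A dart outside a connected spanning set of darts closes up to a cycle. -/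
theorem exists_isCycle {S : Set D} (hS : ∀ d ∈ S, X.inv d ∈ S)
    (hconn : ∀ v w, Relation.ReflTransGen (X.StepIn S) v w) {d : D} (hd : d ∉ S) :
    ∃ (m : ℕ) (c : Fin (m + 1) → D), (∀ i, c i ∈ S ∨ c i = d) ∧ X.IsCycle c := by
  classical
  obtain ⟨f, hf, hfS⟩ := exists_isArborescence (fun v => hconn v (X.src d))
  obtain ⟨rk, hrk⟩ := hf.exists_rank
  -- `q` follows the arborescence from the end of `d` towards the root `X.src d`, which it reaches
  -- first at step `m`.
  let q : ℕ → V := fun n =>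
    Nat.rec (motive := fun _ => V) (X.tgt d) (fun _ v => ((f v).map X.tgt).getD v) n
  have hq0 : q 0 = X.tgt d := rfl
  have hqs : ∀ n, q (n + 1) = ((f (q n)).map X.tgt).getD (q n) := fun n => rfl
  have hlt : ∀ n, q n ≠ X.src d → rk (q (n + 1)) < rk (q n) := by
    intro n hn
    rcases he : f (q n) with _ | e
    · exact absurd ((hf.eq_none_iff _).1 he) hn
    · rw [hqs, he]
      exact hrk _ _ he
  have hex : ∃ n, q n = X.src d := by
    by_contra! hcon
    have : ∀ n, rk (q n) + n ≤ rk (q 0) := by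
      intro n
      induction n with
      | zero => simp
      | succ n ih => have := hlt n (hcon n); omega
    have := this (rk (q 0) + 1)
    omega
  have hm := Nat.find_spec hex
  have hmin : ∀ n < Nat.find hex, q n ≠ X.src d := fun n hn => Nat.find_min hex hn
  generalize Nat.find hex = m at hm hmin
  have hmono : ∀ i j, i < j → j ≤ m → rk (q j) < rk (q i) := by
    intro i j hij
    induction hij with
    | refl => intro hj; exact hlt i (hmin i (by omega))
    | @step k hk ih =>
      intro hj
      exact (hlt k (hmin k (by omega))).trans (ih (by omega))
  have hinj : ∀ i j : Fin (m + 1), q i = q j → i = j := by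
    intro i j hij
    rcases lt_trichotomy (i : ℕ) j with h | h | h
    · have := hmono i j h (by omega)
      rw [hij] at this; omega
    · exact Fin.ext h
    · have := hmono j i h (by omega)
      rw [hij] at this; omega
  -- The default value `d` occurs exactly at the index `m`, where `q` is at the root; it closes the
  -- path.
  let c : Fin (m + 1) → D := fun i => (f (q i)).getD d
  have hcm : ∀ i : Fin (m + 1), (i : ℕ) = m → c i = d := by
    intro i hi
    simp [c, hi, hm, (hf.eq_none_iff (X.src d)).2 rfl]
  have hclt : ∀ i : Fin (m + 1), (i : ℕ) ≠ m → f (q i) = some (c i) := by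
    intro i hi
    rcases he : f (q i) with _ | e
    · exact absurd ((hf.eq_none_iff _).1 he) (hmin i (by omega))
    · simp [c, he]
  have hsrc : ∀ i, X.src (c i) = q i := by
    intro i
    by_cases hi : (i : ℕ) = m
    · rw [hcm i hi, hi, hm]
    · exact hf.src_eq _ _ (hclt i hi)
  have htgt : ∀ i, X.tgt (c i) = q (i + 1 : Fin (m + 1)) := by
    intro i
    by_cases hi : (i : ℕ) = m
    · have : i = Fin.last m := Fin.ext hi
      rw [hcm i hi, this, Fin.last_add_one]; rfl
    · have : ((i + 1 : Fin (m + 1)) : ℕ) = i + 1 :=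
        Fin.val_add_one_of_lt (Fin.lt_last_iff_ne_last.2 fun h => hi (by simp [h]))
      rw [this, hqs, hclt i hi]; rfl
  refine ⟨m, c, fun i => ?_, fun i => by rw [htgt, hsrc], fun i j hij => ⟨fun h => ?_, fun h => ?_⟩,
    fun i j hij h => ?_⟩
  · by_cases hi : (i : ℕ) = m
    · exact Or.inr (hcm i hi)
    · exact Or.inl (hfS _ _ (hclt i hi))
  · exact hij (hinj i j (by rw [← hsrc, ← hsrc, h]))
  -- Backtracking forces `i = j + 1` and `j = i + 1` cyclically. An index equal to `m` would put `d`
  -- into `S`; otherwise nothing wraps around, which is absurd.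
  · have h1 : i = j + 1 := hinj _ _ (by rw [← hsrc, ← htgt, h, src_inv])
    have h2 : i + 1 = j := hinj _ _ (by rw [← hsrc j, ← htgt, h, tgt_inv])
    have hmem : ∀ i : Fin (m + 1), (i : ℕ) ≠ m → c i ∈ S := fun i hi => hfS _ _ (hclt i hi)
    by_cases hi : (i : ℕ) = m
    · have hj : (j : ℕ) ≠ m := fun hj => hij (Fin.ext (hi.trans hj.symm))
      have := hS _ (hmem j hj)
      rw [← h, hcm i hi] at this
      exact hd this
    · by_cases hj : (j : ℕ) = m
      · have := hS _ (hmem i hi)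
        rw [h, hcm j hj, X.inv_inv] at this
        exact hd this
      · have e1 : ((j + 1 : Fin (m + 1)) : ℕ) = j + 1 :=
          Fin.val_add_one_of_lt (Fin.lt_last_iff_ne_last.2 fun h => hj (by simp [h]))
        have e2 : ((i + 1 : Fin (m + 1)) : ℕ) = i + 1 :=
          Fin.val_add_one_of_lt (Fin.lt_last_iff_ne_last.2 fun h => hi (by simp [h]))
        rw [← h1] at e1
        rw [h2] at e2
        omega
  · rw [htgt, htgt] at h
    exact hij (add_right_cancel (hinj _ _ h))

theorem Subgraph.isAcyclic_iff (H : X.Subgraph) :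
    H.toMultigraph.IsAcyclic ↔
      ∀ (m : ℕ) (c : Fin (m + 1) → D), (∀ i, c i ∈ H.darts) → ¬ X.IsCycle c := by
  refine ⟨fun h m c hc hcyc => h m (fun i => ⟨c i, hc i⟩) ?_,
    fun h m c hcyc => h m (fun i => c i) (fun i => (c i).2) ?_⟩
  all_goals
    simpa [IsCycle, tgt, Subgraph.toMultigraph, Subtype.ext_iff] using hcyc

theorem Subgraph.reflTransGen_iff (H : X.Subgraph) (v w : H.verts) :
    Relation.ReflTransGen (fun a b => ∃ d, H.toMultigraph.src d = a ∧ H.toMultigraph.tgt d = b)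
      v w ↔ Relation.ReflTransGen (X.StepIn H.darts) v w := by
  constructor
  · intro h
    induction h with
    | refl => exact .refl
    | tail _ h ih =>
      obtain ⟨d, rfl, rfl⟩ := h
      exact ih.tail ⟨d, d.2, rfl, rfl⟩
  · obtain ⟨w, hw⟩ := w
    intro h
    dsimp only at h
    induction h with
    | refl => exact .refl
    | tail _ h ih =>
      obtain ⟨d, hd, rfl, rfl⟩ := h
      exact (ih (H.src_mem d hd)).tail ⟨⟨d, hd⟩, rfl, rfl⟩

theorem Subgraph.isSpanningTree_iff (H : X.Subgraph) :
    H.IsSpanningTree ↔ H.verts = Set.univ ∧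
      (Nonempty V ∧ ∀ v w, Relation.ReflTransGen (X.StepIn H.darts) v w) ∧
      ∀ (m : ℕ) (c : Fin (m + 1) → D), (∀ i, c i ∈ H.darts) → ¬ X.IsCycle c := by
  unfold IsSpanningTree
  rw [H.isAcyclic_iff]
  refine and_congr_right fun hu => and_congr_left fun _ => ?_
  have hm : ∀ v, v ∈ H.verts := fun v => hu ▸ Set.mem_univ v
  refine and_congr ⟨fun ⟨v⟩ => ⟨v⟩, fun ⟨v⟩ => ⟨v, hm v⟩⟩
    ⟨fun h v w => ?_, fun h v w => ?_⟩
  · exact (H.reflTransGen_iff ⟨v, hm v⟩ ⟨w, hm w⟩).1 (h _ _)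
  · exact (H.reflTransGen_iff v w).2 (h _ _)

/-- The spanning subgraph of an arborescence. -/
def arborescenceSubgraph (X : Multigraph V D) (f : V → Option D) : X.Subgraph where
  verts := Set.univ
  darts := X.arborescenceDarts f
  inv_mem _ := inv_mem_arborescenceDarts
  src_mem _ _ := trivial

theorem IsArborescence.isSpanningTree {r : V} {f : V → Option D} (hf : X.IsArborescence r f) :
    (X.arborescenceSubgraph f).IsSpanningTree :=
  (Subgraph.isSpanningTree_iff _).2 ⟨rfl, ⟨⟨r⟩, hf.reflTransGen_any⟩, fun _ => hf.not_isCycle⟩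

/-- Spanning trees correspond to the arborescences with a given root. -/
theorem kappa_eq_card_arborescence (X : Multigraph V D) (r : V) :
    X.kappa = Nat.card {f : V → Option D // X.IsArborescence r f} := by
  refine (Nat.card_congr (Equiv.ofBijective
    (fun f => ⟨X.arborescenceSubgraph f.1, f.2.isSpanningTree⟩) ⟨?_, ?_⟩)).symm
  · rintro ⟨f, hf⟩ ⟨g, hg⟩ h
    have h' := congrArg Subgraph.darts (Subtype.ext_iff.1 h)
    exact Subtype.ext (hf.eq_of_darts_eq hg h')
  · rintro ⟨H, hH⟩
    obtain ⟨h1, ⟨-, h2⟩, h3⟩ := H.isSpanningTree_iff.1 hH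
    obtain ⟨f, hf, hfH⟩ := exists_isArborescence (fun v => h2 v r)
    refine ⟨⟨f, hf⟩, Subtype.ext (Subgraph.ext h1.symm (Set.Subset.antisymm ?_ fun d hd => ?_))⟩
    · rintro d ⟨v, hv | hv⟩
      · exact hfH v d hv
      · have := H.inv_mem _ (hfH v _ hv)
        rwa [X.inv_inv] at this
    -- A tree containing the arborescence has no further dart: an extra one would close up to a
    -- cycle.
    · by_contra hn
      obtain ⟨m, c, hc, hcyc⟩ := exists_isCycle (S := X.arborescenceDarts f)
        (fun _ => inv_mem_arborescenceDarts) hf.reflTransGen_any hn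
      refine h3 m c (fun i => ?_) hcyc
      rcases hc i with ⟨v, hv | hv⟩ | hi
      · exact hfH v _ hv
      · have := H.inv_mem _ (hfH v _ hv)
        rwa [X.inv_inv] at this
      · exact hi ▸ hd

theorem IsConnected.kappa_pos [Finite V] [Finite D] (hX : X.IsConnected) : 0 < X.kappa := by
  obtain ⟨⟨r⟩, h⟩ := hX
  rw [kappa_eq_card_arborescence X r, Nat.card_pos_iff]
  obtain ⟨f, hf, -⟩ := exists_isArborescence (X := X) (S := Set.univ) (r := r)
    (fun v => Relation.ReflTransGen.mono (fun a b ⟨d, h1, h2⟩ => ⟨d, trivial, h1, h2⟩) _ _ (h v r))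
  exact ⟨⟨f, hf⟩, inferInstance⟩

end Multigraph

/-! ### The Laplacian and the matrix-tree theorem -/

namespace Multigraph

variable {V D : Type*} [Fintype V] [DecidableEq V] [Fintype D] (X : Multigraph V D)

/-- The Laplacian of a multigraph. -/
def lap : Matrix V V ℚ := fun v =>
  ∑ d with X.src d = v, (Pi.single v 1 - Pi.single (X.tgt d) 1)

/-- The row at `v` of the matrix `1 - P`, where `P` is the transition matrix of a choice of
outgoing darts; without an outgoing dart the row is that of the identity matrix. -/
def arborescenceRow (v : V) (o : Option D) : V → ℚ :=
  Pi.single v 1 - o.elim 0 fun d => Pi.single (X.tgt d) 1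

/-- The possible choices at `v` in an arborescence with root `r`. -/
def arborescenceChoices (r v : V) : Finset (Option D) :=
  if v = r then {none} else Finset.map .some {d | X.src d = v}

omit [Fintype V] in
theorem mem_arborescenceChoices_iff (r : V) (f : V → Option D) :
    (∀ v, f v ∈ X.arborescenceChoices r v) ↔
      (∀ v, f v = none ↔ v = r) ∧ ∀ v d, f v = some d → X.src d = v := by
  rw [← forall_and]
  refine forall_congr' fun v => ?_
  by_cases hv : v = r
  · cases hf : f v <;> simp [arborescenceChoices, hv]
  · cases hf : f v <;> simp [arborescenceChoices, hv]

variable {X}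

-- Chosen darts lower the rank, so ordering by rank makes the matrix triangular with identity
-- diagonal blocks.
omit [Fintype D] in
theorem IsArborescence.det_eq_one {r : V} {f : V → Option D} (hf : X.IsArborescence r f) :
    det (fun v => X.arborescenceRow v (f v)) = 1 := by
  obtain ⟨rk, hrk⟩ := hf.exists_rank
  have hle : ∀ v w, rk v ≤ rk w → X.arborescenceRow v (f v) w = (1 : Matrix V V ℚ) v w := by
    intro v w hvw
    rcases he : f v with _ | d
    · simp [arborescenceRow, Matrix.one_apply, Pi.single_apply, eq_comm]
    · have := hrk v d he
      have hne : w ≠ X.tgt d := by rintro rfl; omega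
      simp [arborescenceRow, Matrix.one_apply, Pi.single_apply, eq_comm (a := w), hne.symm]
  have hT : BlockTriangular (fun v => X.arborescenceRow v (f v))
      (fun v => OrderDual.toDual (rk v)) := by
    intro v w hvw
    have hvw' : rk v < rk w := hvw
    refine (hle v w hvw'.le).trans (Matrix.one_apply_ne ?_)
    rintro rfl
    omega
  rw [hT.det]
  refine Finset.prod_eq_one fun a _ => ?_
  have : toSquareBlock (fun v => X.arborescenceRow v (f v))
      (fun v => OrderDual.toDual (rk v)) a = 1 := by
    ext ⟨v, hv⟩ ⟨w, hw⟩
    have hvw : rk v = rk w := OrderDual.toDual.injective (hv.trans hw.symm)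
    exact (hle v w hvw.le).trans (by simp [Matrix.one_apply])
  rw [this, det_one]

/-- The indicator function of the vertices from which the root is not reached is a nonzero kernel
vector: it is constant along the chosen darts and vanishes at the root. -/
theorem det_eq_zero_of_not_isArborescence {r : V} {f : V → Option D}
    (hc : ∀ v, f v ∈ X.arborescenceChoices r v) (hf : ¬ X.IsArborescence r f) :
    det (fun v => X.arborescenceRow v (f v)) = 0 := by
  classical
  obtain ⟨h1, h2⟩ := (X.mem_arborescenceChoices_iff r f).1 hc
  let R : V → V → Prop := fun v w => ∃ d, f v = some d ∧ X.tgt d = w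
  have hR : ¬ ∀ v, Relation.ReflTransGen R v r := by
    intro h
    obtain ⟨rk, hrk⟩ := exists_rank_of_reflTransGen R r h
    refine hf ⟨h1, h2, rk, fun v d hd => ?_⟩
    obtain ⟨w, ⟨e, he, rfl⟩, hw⟩ := hrk v (fun hv => by simp [(h1 v).2 hv] at hd)
    rwa [Option.some.inj (hd.symm.trans he)]
  push Not at hR
  obtain ⟨v₀, hv₀⟩ := hR
  refine exists_mulVec_eq_zero_iff.1
    ⟨fun v => if Relation.ReflTransGen R v r then 0 else 1, fun h => ?_, funext fun v => ?_⟩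
  · simpa [hv₀] using congrFun h v₀
  · rcases he : f v with _ | d
    · have hvr : v = r := (h1 v).1 he
      change X.arborescenceRow v (f v) ⬝ᵥ _ = 0
      rw [he, hvr]
      simp [arborescenceRow, Relation.ReflTransGen.refl]
    · have hiff : Relation.ReflTransGen R (X.tgt d) r ↔ Relation.ReflTransGen R v r := by
        refine ⟨fun h => .head ⟨d, he, rfl⟩ h, fun h => ?_⟩
        rcases Relation.ReflTransGen.cases_head h with h | ⟨w, ⟨e, he', rfl⟩, hw⟩
        · simp [(h1 v).2 h] at he
        · rwa [Option.some.inj (he.symm.trans he')]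
      change X.arborescenceRow v (f v) ⬝ᵥ _ = 0
      simp [arborescenceRow, he, sub_dotProduct, hiff]

omit [Fintype V] in
theorem sum_arborescenceRow (r v : V) :
    ∑ o ∈ X.arborescenceChoices r v, X.arborescenceRow v o =
      X.lap.updateRow r (Pi.single r 1) v := by
  by_cases hv : v = r
  · subst hv
    simp [arborescenceChoices, arborescenceRow]
  · rw [updateRow_ne hv]
    simp [arborescenceChoices, arborescenceRow, hv, lap]

/-- The matrix-tree theorem. -/
theorem adjugate_lap_self (X : Multigraph V D) (r : V) : X.lap.adjugate r r = X.kappa := by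
  classical
  rw [adjugate_apply]
  -- Each row is a sum over the choices at its vertex, so multilinearity expands the cofactor over
  -- all choice functions; exactly the arborescences contribute `1`.
  have h1 : X.lap.updateRow r (Pi.single r 1) =
      fun v => ∑ o ∈ X.arborescenceChoices r v, X.arborescenceRow v o :=
    funext fun v => (sum_arborescenceRow r v).symm
  rw [h1]
  have h2 := (detRowAlternating (n := V) (R := ℚ)).toMultilinearMap.map_sum_finset
    (fun v o => X.arborescenceRow v o) (X.arborescenceChoices r)
  refine h2.trans ?_
  have h3 : ∀ f ∈ Fintype.piFinset (X.arborescenceChoices r),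
      det (fun v => X.arborescenceRow v (f v)) = if X.IsArborescence r f then 1 else 0 := by
    intro f hf
    split_ifs with h
    · exact h.det_eq_one
    · exact det_eq_zero_of_not_isArborescence (Fintype.mem_piFinset.1 hf) h
  refine (Finset.sum_congr rfl h3).trans ?_
  rw [Finset.sum_boole, kappa_eq_card_arborescence X r, Nat.card_eq_fintype_card,
    Fintype.card_subtype]
  congr 2
  ext f
  simp only [Finset.mem_filter, Fintype.mem_piFinset, Finset.mem_univ, true_and,
    mem_arborescenceChoices_iff]
  exact ⟨fun h => h.2, fun h => ⟨⟨h.eq_none_iff, h.src_eq⟩, h⟩⟩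

theorem lap_mulVec_one (X : Multigraph V D) : X.lap *ᵥ 1 = 0 := by
  ext v
  change X.lap v ⬝ᵥ 1 = 0
  rw [lap, sum_dotProduct]
  exact Finset.sum_eq_zero fun d _ => by simp [sub_dotProduct]

/-- Two cofactors differ by a determinant in which one row is a difference of unit vectors. All its
row sums vanish, so it is zero. -/
theorem adjugate_lap (X : Multigraph V D) (v w : V) : X.lap.adjugate v w = X.kappa := by
  rw [← adjugate_lap_self X w, adjugate_apply, adjugate_apply, ← sub_eq_zero]
  have h := det_updateRow_add X.lap w (Pi.single v 1 - Pi.single w 1) (Pi.single w 1)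
  rw [sub_add_cancel] at h
  rw [h, add_sub_cancel_right]
  refine exists_mulVec_eq_zero_iff.1 ⟨1, fun h => one_ne_zero (congrFun h v), funext fun u => ?_⟩
  by_cases hu : u = w
  · subst hu
    change X.lap.updateRow u _ u ⬝ᵥ 1 = 0
    simp [sub_dotProduct]
  · have := congrFun X.lap_mulVec_one u
    simpa [mulVec, updateRow_ne hu] using this

/-- The determinant of the Laplacian perturbed by a constant matrix. -/
theorem det_lap_add_const [Nonempty V] (X : Multigraph V D) (c : ℚ) :
    (X.lap + of fun _ _ => c).det = c * Fintype.card V ^ 2 * X.kappa := by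
  obtain ⟨r⟩ := ‹Nonempty V›
  set A := X.lap + of fun _ _ => c with hA
  have h1 : A *ᵥ 1 = (c * Fintype.card V) • (1 : V → ℚ) := by
    rw [hA, add_mulVec, lap_mulVec_one]
    ext v
    simp [mulVec, dotProduct_one, mul_comm]
  -- The vector `1` is an eigenvector for `c n`; Cramer's rule pulls this factor out of column `r`.
  have h2 : A.det = c * Fintype.card V * (A.updateCol r 1).det := by
    have h := congrFun (cramer_eq_adjugate_mulVec A (A *ᵥ 1)) r
    rw [mulVec_mulVec, adjugate_mul, h1, cramer_apply, det_updateCol_smul] at h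
    simpa [smul_mulVec] using h.symm
  -- Subtracting `c` times the all-ones column from the others removes the perturbation.
  have h3 : (A.updateCol r 1).det = (X.lap.updateCol r 1).det := by
    rw [← det_transpose, ← det_transpose (X.lap.updateCol r 1)]
    refine det_eq_of_forall_row_eq_smul_add_const (fun j => if j = r then 0 else c) r (by simp)
      fun j i => ?_
    by_cases hj : j = r
    · simp [hj]
    · simp [hj, hA]
  have h4 : (X.lap.updateCol r 1).det = Fintype.card V * X.kappa := by
    rw [← cramer_apply, cramer_eq_adjugate_mulVec]
    simp [mulVec, dotProduct_one, adjugate_lap]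
  rw [h2, h3, h4]
  ring

end Multigraph

/-! ### Determinants of circulant block matrices -/

/-- The determinant of a matrix of two by two blocks that is circulant. -/
theorem Matrix.det_circulant_bool {n R : Type*} [Fintype n] [DecidableEq n] [CommRing R]
    (N : Bool → Matrix n n R) (A : Matrix (Bool × n) (Bool × n) R)
    (hA : ∀ a b i j, A (a, i) (b, j) = N (a ^^ b) i j) :
    A.det = (N false + N true).det * (N false - N true).det := by
  have h1 : A.reindex (Equiv.boolProdEquivSum n) (Equiv.boolProdEquivSum n) =
      fromBlocks (N false) (N true) (N true) (N false) := by
    ext (i | i) (j | j) <;> simp [Equiv.boolProdEquivSum, hA]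
  have h2 : fromBlocks (1 : Matrix n n R) 1 0 1 * fromBlocks (N false) (N true) (N true) (N false) =
      fromBlocks (N false + N true) 0 (N true) (N false - N true) * fromBlocks 1 1 0 1 := by
    rw [fromBlocks_multiply, fromBlocks_multiply]
    congr 1 <;> simp [add_comm]
  have h3 := congrArg det h2
  simp only [det_mul, det_fromBlocks_zero₂₁, det_fromBlocks_zero₁₂, det_one, one_mul, mul_one] at h3
  rw [← det_reindex_self (Equiv.boolProdEquivSum n) A, h1, h3]

/-! ### Coverings, unique lifting and deck transformations -/

namespace Multigraph

section Hom

variable {V D V' D' V'' D'' : Type*} {X : Multigraph V D} {Y : Multigraph V' D'}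
  {Z : Multigraph V'' D''}

theorem Hom.tgt_onD (f : Hom Y X) (d : D') : X.tgt (f.onD d) = f.onV (Y.tgt d) := by
  rw [tgt, f.inv_onD, f.src_onD, tgt]

theorem Hom.IsCovering.onV_surjective {f : Hom Y X} (hf : f.IsCovering) (hX : X.IsConnected)
    [Nonempty V'] : Function.Surjective f.onV := by
  obtain ⟨w⟩ := ‹Nonempty V'›
  intro v
  induction hX.2 (f.onV w) v with
  | refl => exact ⟨w, rfl⟩
  | tail _ h ih =>
    obtain ⟨u, hu⟩ := ih
    obtain ⟨d, h1, rfl⟩ := h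
    obtain ⟨e, -, rfl⟩ := (hf u).surjOn (h1.trans hu.symm)
    exact ⟨_, (f.tgt_onD e).symm⟩

theorem Hom.IsCovering.onD_surjective {f : Hom Y X} (hf : f.IsCovering) (hX : X.IsConnected)
    [Nonempty V'] : Function.Surjective f.onD := by
  intro d
  obtain ⟨w, hw⟩ := hf.onV_surjective hX (X.src d)
  obtain ⟨e, -, he⟩ := (hf w).surjOn (show X.src d = f.onV w from hw.symm)
  exact ⟨e, he⟩

theorem Hom.IsCovering.onD_ext {f : Hom Y X} (hf : f.IsCovering) {d e : D'}
    (h : Y.src d = Y.src e) (h' : f.onD d = f.onD e) : d = e :=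
  (hf (Y.src e)).injOn h rfl h'

/-- Two lifts of a morphism through a covering agree if they agree at one vertex. -/
theorem Hom.IsCovering.lift_unique {p : Hom Y X} (hp : p.IsCovering) (hZ : Z.IsConnected)
    {g h : Hom Z Y} (hgh : p.comp g = p.comp h) {w : V''} (hw : g.onV w = h.onV w) : g = h := by
  have hD : ∀ d, g.onV (Z.src d) = h.onV (Z.src d) → g.onD d = h.onD d := fun d hd =>
    hp.onD_ext (by rw [g.src_onD, h.src_onD, hd]) (congrFun (congrArg Hom.onD hgh) d)
  have hV : ∀ v, g.onV v = h.onV v := by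
    intro v
    induction hZ.2 w v with
    | refl => exact hw
    | tail _ h' ih =>
      obtain ⟨d, rfl, rfl⟩ := h'
      rw [← tgt_onD, ← tgt_onD, hD d ih]
  exact Hom.ext (funext hV) (funext fun d => hD d (hV _))

/-- A covering intertwines the Laplacians. -/
theorem Hom.IsCovering.sum_lap [Fintype V] [DecidableEq V] [Fintype D] [Fintype V']
    [DecidableEq V'] [Fintype D'] {f : Hom Y X} (hf : f.IsCovering) (w : V') (v : V) :
    ∑ u with f.onV u = v, Y.lap w u = X.lap (f.onV w) v := by
  simp only [lap, Finset.sum_apply, Pi.sub_apply]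
  rw [Finset.sum_comm]
  refine Finset.sum_nbij f.onD ?_ ?_ ?_ ?_
  · intro d hd
    simp only [Finset.mem_filter, Finset.mem_univ, true_and] at hd ⊢
    rw [f.src_onD, hd]
  · simpa using (hf w).injOn
  · simpa using (hf w).surjOn
  · intro d _
    rw [Finset.sum_sub_distrib, f.tgt_onD]
    simp [Pi.single_apply, Finset.sum_ite_eq', eq_comm]

/-- A covering automorphism as a morphism. -/
def Hom.deckHom {π : Hom Y X} (σ : π.deck) : Hom Y Y where
  onV := σ.1.1
  onD := σ.1.2
  src_onD := σ.2.1
  inv_onD := σ.2.2.1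

theorem Hom.onV_deck {π : Hom Y X} (σ : π.deck) (w : V') : π.onV (σ.1.1 w) = π.onV w :=
  σ.2.2.2.1 w

theorem Hom.comp_deckHom {π : Hom Y X} (σ : π.deck) : π.comp (deckHom σ) = π :=
  Hom.ext (funext σ.2.2.2.1) (funext σ.2.2.2.2)

theorem Hom.deckHom_isCovering {π : Hom Y X} (σ : π.deck) : (deckHom σ).IsCovering := by
  intro w
  refine ⟨fun d hd => ?_, σ.1.2.injective.injOn, fun d hd => ?_⟩
  · exact (σ.2.1 d).trans (congrArg _ hd)
  · refine ⟨σ.1.2.symm d, σ.1.1.injective ?_, σ.1.2.apply_symm_apply d⟩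
    rw [← σ.2.1, Equiv.apply_symm_apply]
    exact hd

/-- A deck transformation is itself a covering, with one-point fibres, so `sum_lap` has a single
term. -/
theorem Hom.lap_deck [Fintype V'] [DecidableEq V'] [Fintype D'] {π : Hom Y X} (σ : π.deck)
    (v w : V') : Y.lap (σ.1.1 v) (σ.1.1 w) = Y.lap v w := by
  rw [show σ.1.1 v = (deckHom σ).onV v from rfl, ← (deckHom_isCovering σ).sum_lap v]
  simp [deckHom, Finset.filter_eq']

/-- The deck group acts freely on the vertices. -/
theorem Hom.IsCovering.deck_ext {π : Hom Y X} (hπ : π.IsCovering) (hY : Y.IsConnected)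
    {σ τ : π.deck} {w : V'} (h : σ.1.1 w = τ.1.1 w) : σ = τ := by
  have := hπ.lift_unique hY (g := deckHom σ) (h := deckHom τ)
    (by rw [comp_deckHom, comp_deckHom]) h
  refine Subtype.ext (Prod.ext (Equiv.ext fun v => ?_) (Equiv.ext fun d => ?_))
  · exact congrFun (congrArg Hom.onV this) v
  · exact congrFun (congrArg Hom.onD this) d

end Hom

/-! ### Intermediate double covers as sign characters -/

namespace IntermediateDoubleCover

variable {V D V' D' : Type*} {X : Multigraph V D} {Y : Multigraph V' D'} {π : Hom Y X}

section Character

variable (A : IntermediateDoubleCover π)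

theorem toBase_fromTop (w : V') : A.toBase.onV (A.fromTop.onV w) = π.onV w :=
  congrFun (congrArg Hom.onV A.comp_eq) w

theorem toBase_fromTop_onD (d : D') : A.toBase.onD (A.fromTop.onD d) = π.onD d :=
  congrFun (congrArg Hom.onD A.comp_eq) d

open Classical in
/-- The sign character of the deck group with the automorphisms over the intermediate cover as its
kernel, with values `false` and `true`. -/
noncomputable def character (σ : π.deck) : Bool :=
  decide (∃ w, A.fromTop.onV (σ.1.1 w) ≠ A.fromTop.onV w)

variable {A}

/-- `A.fromTop` and its composite with `σ` both lift `π` through `A.toBase`, so agreement at one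
vertex is agreement everywhere. -/
theorem fromTop_deck_eq_iff (hY : Y.IsConnected) (σ : π.deck) (w : V') :
    A.fromTop.onV (σ.1.1 w) = A.fromTop.onV w ↔ A.character σ = false := by
  simp only [character, ne_eq, decide_eq_false_iff_not, not_exists, not_not]
  refine ⟨fun h => ?_, fun h => h w⟩
  have := A.toBase_covering.lift_unique hY (g := A.fromTop.comp (Hom.deckHom σ)) (h := A.fromTop)
    (w := w) ?_ h
  · exact congrFun (congrArg Hom.onV this)
  · rw [A.comp_eq]
    exact (congrArg (fun f => Hom.comp f (Hom.deckHom σ)) A.comp_eq).trans (Hom.comp_deckHom σ)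

theorem eq_of_ne_of_ne {a b c : A.V₁} (hab : A.toBase.onV a = A.toBase.onV b)
    (hbc : A.toBase.onV b = A.toBase.onV c) (h : a ≠ b) (h' : b ≠ c) : a = c := by
  obtain ⟨x, y, -, hxy⟩ := Nat.card_eq_two_iff.1 (A.toBase_degree (A.toBase.onV b))
  have key : ∀ z : A.V₁, A.toBase.onV z = A.toBase.onV b → z = x.1 ∨ z = y.1 := by
    intro z hz
    have : (⟨z, hz⟩ : {w // A.toBase.onV w = A.toBase.onV b}) ∈ ({x, y} : Set _) :=
      hxy ▸ Set.mem_univ _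
    simpa [Subtype.ext_iff] using this
  rcases key a hab with ha | ha <;> rcases key b rfl with hb | hb <;>
    rcases key c hbc.symm with hc | hc <;> simp_all

/-- A deck transformation either fixes or swaps the two points of a fibre of `A.toBase`, and two
swaps cancel. -/
theorem character_mul (hY : Y.IsConnected) (σ τ : π.deck) :
    A.character (σ * τ) = (A.character σ ^^ A.character τ) := by
  obtain ⟨w⟩ := hY.1
  have h1 := fromTop_deck_eq_iff (A := A) hY τ w
  have h2 := fromTop_deck_eq_iff (A := A) hY σ (τ.1.1 w)
  have h3 := fromTop_deck_eq_iff (A := A) hY (σ * τ) w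
  rw [show (σ * τ).1.1 w = σ.1.1 (τ.1.1 w) from rfl] at h3
  have h4 := eq_of_ne_of_ne (A := A) (a := A.fromTop.onV (σ.1.1 (τ.1.1 w)))
    (b := A.fromTop.onV (τ.1.1 w)) (c := A.fromTop.onV w)
    (by rw [toBase_fromTop, toBase_fromTop, Hom.onV_deck])
    (by rw [toBase_fromTop, toBase_fromTop, Hom.onV_deck])
  cases hσ : A.character σ <;> cases hτ : A.character τ <;>
    cases hστ : A.character (σ * τ) <;> simp_all

theorem fromTop_deck_eq_deck_iff (hY : Y.IsConnected) (σ τ : π.deck) (w : V') :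
    A.fromTop.onV (σ.1.1 w) = A.fromTop.onV (τ.1.1 w) ↔ A.character σ = A.character τ := by
  have h := fromTop_deck_eq_iff (A := A) hY (σ * τ⁻¹) (τ.1.1 w)
  have hσ : (σ * τ⁻¹).1.1 (τ.1.1 w) = σ.1.1 w := by
    change (σ * τ⁻¹ * τ).1.1 w = σ.1.1 w
    rw [inv_mul_cancel_right]
  rw [hσ] at h
  have hmul := character_mul (A := A) hY (σ * τ⁻¹) τ
  rw [inv_mul_cancel_right] at hmul
  rw [h, hmul]
  cases A.character (σ * τ⁻¹) <;> cases A.character τ <;> decide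

theorem exists_character_eq_true (hY : Y.IsConnected) (hπ : π.IsGalois) :
    ∃ σ, A.character σ = true := by
  obtain ⟨w⟩ := hY.1
  have : Nonempty V' := ⟨w⟩
  obtain ⟨x, y, hne, -⟩ := Nat.card_eq_two_iff.1 (A.toBase_degree (π.onV w))
  obtain ⟨z, hz, hzw⟩ : ∃ z, A.toBase.onV z = π.onV w ∧ z ≠ A.fromTop.onV w := by
    by_cases hx : x.1 = A.fromTop.onV w
    · exact ⟨y.1, y.2, fun hy => hne (Subtype.ext (hx.trans hy.symm))⟩
    · exact ⟨x.1, x.2, hx⟩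
  obtain ⟨w', rfl⟩ := A.fromTop_covering.onV_surjective A.connected z
  rw [toBase_fromTop] at hz
  obtain ⟨σ, hσ, rfl⟩ := hπ.2 w w' hz.symm
  refine ⟨⟨σ, hσ⟩, ?_⟩
  rw [← Bool.not_eq_false]
  exact fun h => hzw ((fromTop_deck_eq_iff hY ⟨σ, hσ⟩ w).2 h)

/-- By transitivity of the deck group, the fibres of `A.fromTop` are the orbits of the kernel of the
character. -/
theorem fromTop_onV_eq_of_character_eq {B : IntermediateDoubleCover π} (hY : Y.IsConnected)
    (hπ : π.IsGalois) (h : A.character = B.character) {w w' : V'}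
    (hw : A.fromTop.onV w = A.fromTop.onV w') : B.fromTop.onV w = B.fromTop.onV w' := by
  obtain ⟨σ, hσ, rfl⟩ := hπ.2 w w' (by rw [← A.toBase_fromTop, hw, A.toBase_fromTop])
  have := (fromTop_deck_eq_iff (A := A) hY ⟨σ, hσ⟩ w).1 hw.symm
  rw [h] at this
  exact ((fromTop_deck_eq_iff hY ⟨σ, hσ⟩ w).2 this).symm

theorem fromTop_onD_eq_of_character_eq {B : IntermediateDoubleCover π} (hY : Y.IsConnected)
    (hπ : π.IsGalois) (h : A.character = B.character) {d d' : D'}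
    (hd : A.fromTop.onD d = A.fromTop.onD d') : B.fromTop.onD d = B.fromTop.onD d' := by
  refine B.toBase_covering.onD_ext ?_ ?_
  · rw [B.fromTop.src_onD, B.fromTop.src_onD]
    refine fromTop_onV_eq_of_character_eq hY hπ h ?_
    rw [← A.fromTop.src_onD, ← A.fromTop.src_onD, hd]
  · rw [B.toBase_fromTop_onD, B.toBase_fromTop_onD, ← A.toBase_fromTop_onD, hd,
      A.toBase_fromTop_onD]

/-- Intermediate double covers with the same character are equivalent. -/
theorem equivalent_of_character_eq {B : IntermediateDoubleCover π} (hY : Y.IsConnected)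
    (hπ : π.IsGalois) (h : A.character = B.character) : A.Equivalent B := by
  have := hY.1
  have hAV := A.fromTop_covering.onV_surjective A.connected
  have hAD := A.fromTop_covering.onD_surjective A.connected
  have hBV := B.fromTop_covering.onV_surjective B.connected
  have hBD := B.fromTop_covering.onD_surjective B.connected
  have eV : ∀ w, B.fromTop.onV (Function.surjInv hAV (A.fromTop.onV w)) = B.fromTop.onV w :=
    fun w => fromTop_onV_eq_of_character_eq hY hπ h (Function.surjInv_eq hAV _)
  have eD : ∀ d, B.fromTop.onD (Function.surjInv hAD (A.fromTop.onD d)) = B.fromTop.onD d :=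
    fun d => fromTop_onD_eq_of_character_eq hY hπ h (Function.surjInv_eq hAD _)
  -- The isomorphism sends the image in `A` of an element of `Y` to its image in `B`; this is
  -- independent of the preimage because the fibres agree.
  refine ⟨⟨fun a => B.fromTop.onV (Function.surjInv hAV a),
    fun a => B.fromTop.onD (Function.surjInv hAD a), hAD.forall.2 fun d => ?_,
    hAD.forall.2 fun d => ?_⟩, ⟨?_, ?_⟩, ⟨?_, ?_⟩, ?_, ?_⟩
  · rw [eD, A.fromTop.src_onD, eV, B.fromTop.src_onD]
  · rw [eD, A.fromTop.inv_onD, eD, B.fromTop.inv_onD]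
  · refine hAV.forall₂.2 fun w w' hw => ?_
    dsimp only at hw
    rw [eV, eV] at hw
    exact fromTop_onV_eq_of_character_eq hY hπ h.symm hw
  · exact hBV.forall.2 fun w => ⟨A.fromTop.onV w, eV w⟩
  · refine hAD.forall₂.2 fun d d' hd => ?_
    dsimp only at hd
    rw [eD, eD] at hd
    exact fromTop_onD_eq_of_character_eq hY hπ h.symm hd
  · exact hBD.forall.2 fun d => ⟨A.fromTop.onD d, eD d⟩
  · exact Hom.ext (funext eV) (funext eD)
  · refine Hom.ext (funext (hAV.forall.2 fun w => ?_)) (funext (hAD.forall.2 fun d => ?_))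
    · rw [A.toBase_fromTop]
      exact (congrArg B.toBase.onV (eV w)).trans (B.toBase_fromTop w)
    · rw [A.toBase_fromTop_onD]
      exact (congrArg B.toBase.onD (eD d)).trans (B.toBase_fromTop_onD d)

end Character

end IntermediateDoubleCover

end Multigraph

/-! ### Characters of the Klein four-group -/

/-- Three distinct sign characters of the Klein four-group: two of them are coordinates, and the
third one is their product. -/
theorem exists_klein_four_coordinates {G : Type*} [Group G]
    (e : G ≃* Multiplicative (ZMod 2 × ZMod 2)) (χ : Fin 3 → G → Bool)
    (hmul : ∀ i σ τ, χ i (σ * τ) = (χ i σ ^^ χ i τ)) (hne : ∀ i, ∃ σ, χ i σ = true)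
    (hinj : Function.Injective χ) :
    ∃ θ : Bool × Bool → G, Function.Bijective θ ∧
      (∀ k l, θ (k.1 ^^ l.1, k.2 ^^ l.2) = θ k * θ l) ∧
      (∀ k, χ 0 (θ k) = k.1) ∧ (∀ k, χ 1 (θ k) = k.2) ∧ ∀ k, χ 2 (θ k) = (k.1 ^^ k.2) := by
  obtain ⟨g, h, hgh⟩ : ∃ g h : G, ∀ σ, σ = 1 ∨ σ = g ∨ σ = h ∨ σ = g * h := by
    refine ⟨e.symm (.ofAdd (1, 0)), e.symm (.ofAdd (0, 1)), fun σ => ?_⟩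
    have key : ∀ a : ZMod 2 × ZMod 2,
        a = 0 ∨ a = (1, 0) ∨ a = (0, 1) ∨ a = (1, 0) + (0, 1) := by decide
    have := key (e σ).toAdd
    simpa only [MulEquiv.eq_symm_apply, ← map_mul, ← ofAdd_add, ← e.map_eq_one_iff]
  have h1 : ∀ i, χ i 1 = false := fun i => by simpa using hmul i 1 1
  have hext : ∀ i j, χ i g = χ j g → χ i h = χ j h → i = j := by
    intro i j hg hh
    refine hinj (funext fun σ => ?_)
    rcases hgh σ with rfl | rfl | rfl | rfl <;> simp only [h1, hmul, hg, hh]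
  have hnz : ∀ i, χ i g = true ∨ χ i h = true := by
    intro i
    obtain ⟨σ, hσ⟩ := hne i
    by_contra! hcon
    rcases hgh σ with rfl | rfl | rfl | rfl <;> simp_all
  have h01 := hext 0 1
  have h02 := hext 0 2
  have h12 := hext 1 2
  have hn0 := hnz 0
  have hn1 := hnz 1
  have hn2 := hnz 2
  have hsum : ∀ σ, χ 2 σ = (χ 0 σ ^^ χ 1 σ) := by
    -- Values on `g` and `h` determine a character, and three distinct nonzero vectors of a plane
    -- over the field with two elements sum to zero.
    have hg : χ 2 g = (χ 0 g ^^ χ 1 g) ∧ χ 2 h = (χ 0 h ^^ χ 1 h) := by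
      generalize χ 0 g = a0, χ 1 g = a1, χ 2 g = a2, χ 0 h = b0, χ 1 h = b1, χ 2 h = b2 at *
      revert a0 a1 a2 b0 b1 b2
      decide
    intro σ
    rcases hgh σ with rfl | rfl | rfl | rfl
    · simp only [h1, Bool.xor_false]
    · exact hg.1
    · exact hg.2
    · rw [hmul, hmul, hmul, hg.1, hg.2]
      simp only [Bool.xor_assoc, Bool.xor_left_comm]
  have hsurj : Function.Surjective fun σ => (χ 0 σ, χ 1 σ) := by
    have key : ∀ k : Bool × Bool, ∃ x y : Bool,
        (x && χ 0 g ^^ y && χ 0 h) = k.1 ∧ (x && χ 1 g ^^ y && χ 1 h) = k.2 := by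
      generalize χ 0 g = a0, χ 1 g = a1, χ 2 g = a2, χ 0 h = b0, χ 1 h = b1, χ 2 h = b2 at *
      revert a0 a1 a2 b0 b1 b2
      decide
    intro k
    obtain ⟨x, y, hx, hy⟩ := key k
    refine ⟨(if x then g else 1) * (if y then h else 1), Prod.ext ?_ ?_⟩
    · rw [← hx]
      cases x <;> cases y <;> simp [hmul, h1]
    · rw [← hy]
      cases x <;> cases y <;> simp [hmul, h1]
  have : Finite G := .of_equiv _ e.symm.toEquiv
  have hbij := hsurj.bijective_of_nat_card_le (by
    rw [Nat.card_congr e.toEquiv, Nat.card_congr Multiplicative.toAdd]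
    simp)
  let E := Equiv.ofBijective _ hbij
  have hE : ∀ k, (χ 0 (E.symm k), χ 1 (E.symm k)) = k := E.apply_symm_apply
  have hE0 : ∀ k, χ 0 (E.symm k) = k.1 := fun k => congrArg Prod.fst (hE k)
  have hE1 : ∀ k, χ 1 (E.symm k) = k.2 := fun k => congrArg Prod.snd (hE k)
  refine ⟨E.symm, E.symm.bijective, fun k l => hbij.1 ?_, hE0, hE1, fun k => ?_⟩
  · simp only [hmul, hE0, hE1]
  · rw [hsum, hE0, hE1]

/-! ### Factoring the Laplacian determinants over characters -/

namespace Multigraph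

section

variable {V D V' D' : Type*} [Fintype V] [DecidableEq V] [Fintype D] [Fintype V'] [DecidableEq V']
  [Fintype D'] {X : Multigraph V D} {Y : Multigraph V' D'} {π : Hom Y X}

/-- Coordinates on a Galois covering with group `Bool × Bool` (with the operation `xor`), in which
the Laplacian is circulant. -/
structure KleinCoordinates (π : Hom Y X) where
  equiv : (Bool × Bool) × V ≃ V'
  block : Bool × Bool → Matrix V V ℚ
  onV_equiv : ∀ k v, π.onV (equiv (k, v)) = v
  lap_equiv : ∀ k l v w,
    Y.lap (equiv (k, v)) (equiv (l, w)) = block (k.1 ^^ l.1, k.2 ^^ l.2) v w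

namespace KleinCoordinates

variable (C : KleinCoordinates π)

theorem lap_base (hπ : π.IsCovering) : X.lap = ∑ k, C.block k := by
  ext v w
  have h := hπ.sum_lap (C.equiv ((false, false), v)) w
  rw [C.onV_equiv] at h
  rw [← h, Finset.sum_filter, ← C.equiv.sum_comp, Fintype.sum_prod_type, Matrix.sum_apply]
  refine Finset.sum_congr rfl fun k _ => ?_
  simp [C.onV_equiv, C.lap_equiv]

/-- This compares `det (L_Y + J) = (4n)² κ_Y` with its factorisation over the four characters, whose
trivial factor is `det (L_X + 4 J) = 4 n² κ_X`. -/
theorem kappa_top [Nonempty V] (hπ : π.IsCovering) :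
    4 * (Y.kappa : ℚ) = X.kappa *
      ((C.block (false, false) + C.block (false, true) -
        (C.block (true, false) + C.block (true, true))).det *
      (C.block (false, false) + C.block (true, false) -
        (C.block (false, true) + C.block (true, true))).det *
      (C.block (false, false) + C.block (true, true) -
        (C.block (true, false) + C.block (false, true))).det) := by
  have : Nonempty V' := ⟨C.equiv ((true, true), Classical.arbitrary V)⟩
  have hcard : (Fintype.card V' : ℚ) = 4 * Fintype.card V := by
    rw [← Fintype.card_congr C.equiv]
    simp
  have h1 := det_lap_add_const Y 1
  have h2 := det_lap_add_const X 4
  let J : Matrix V V ℚ := of fun _ _ => 1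
  let e : V' ≃ Bool × Bool × V := C.equiv.symm.trans (Equiv.prodAssoc _ _ _)
  -- The first group coordinate is split off; each `N a` is still circulant in the second. The
  -- entrywise `+ 1` is the all-ones perturbation.
  let N : Bool → Matrix (Bool × V) (Bool × V) ℚ := fun a =>
    of fun x y => C.block (a, x.1 ^^ y.1) x.2 y.2 + 1
  rw [← det_reindex_self e, det_circulant_bool N,
    det_circulant_bool (fun b => C.block (false, b) + J + (C.block (true, b) + J))
      (N false + N true),
    det_circulant_bool (fun b => C.block (false, b) - C.block (true, b)) (N false - N true)] at h1
  · have h3 : C.block (false, false) + J + (C.block (true, false) + J) +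
        (C.block (false, true) + J + (C.block (true, true) + J)) =
        X.lap + of fun _ _ => 4 := by
      rw [C.lap_base hπ]
      ext v w
      simp [Fintype.sum_prod_type, J]
      ring
    have h4 : C.block (false, false) + J + (C.block (true, false) + J) -
        (C.block (false, true) + J + (C.block (true, true) + J)) =
        C.block (false, false) + C.block (true, false) -
        (C.block (false, true) + C.block (true, true)) := by abel
    have h5 : C.block (false, false) - C.block (true, false) +
        (C.block (false, true) - C.block (true, true)) =
        C.block (false, false) + C.block (false, true) -
        (C.block (true, false) + C.block (true, true)) := by abel
    have h6 : C.block (false, false) - C.block (true, false) -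
        (C.block (false, true) - C.block (true, true)) =
        C.block (false, false) + C.block (true, true) -
        (C.block (true, false) + C.block (false, true)) := by abel
    rw [h3, h4, h5, h6, h2, hcard] at h1
    have hn : (Fintype.card V : ℚ) ≠ 0 := by simp
    refine mul_left_cancel₀ (mul_ne_zero four_ne_zero (pow_ne_zero 2 hn)) ?_
    linear_combination -h1
  · intro a b v w
    simp [N]
  · intro a b v w
    simp [N, J]
  · rintro a b ⟨a', v⟩ ⟨b', w⟩
    simp [N, e, C.lap_equiv]

/-- The graph of `A` has two sheets over `X`, indexed by the values of `χ`, with `g` choosing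
representatives. Its Laplacian blocks are the sums of `C.block` over the fibres of `χ`. -/
theorem kappa_intermediate [Nonempty V] (hπ : π.IsCovering) (A : IntermediateDoubleCover π)
    (χ : Bool × Bool → Bool) (g : Bool → Bool × Bool)
    (hχ : ∀ k l, χ (k.1 ^^ l.1, k.2 ^^ l.2) = (χ k ^^ χ l)) (hg : ∀ a, χ (g a) = a)
    (hA : ∀ k l v, A.fromTop.onV (C.equiv (k, v)) = A.fromTop.onV (C.equiv (l, v)) ↔ χ k = χ l) :
    2 * (A.graph.kappa : ℚ) =
      X.kappa * (∑ k with χ k = false, C.block k - ∑ k with χ k = true, C.block k).det := by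
  classical
  have := A.finite_V
  have := A.finite_D
  let _ := Fintype.ofFinite A.V₁
  let _ := Fintype.ofFinite A.D₁
  let v₀ := Classical.arbitrary V
  have : Nonempty V' := ⟨C.equiv ((true, true), v₀)⟩
  have : Nonempty A.V₁ := ⟨A.fromTop.onV (C.equiv ((true, true), v₀))⟩
  have hbase : ∀ k v, A.toBase.onV (A.fromTop.onV (C.equiv (k, v))) = v := fun k v => by
    rw [A.toBase_fromTop, C.onV_equiv]
  have hAA : ∀ k l v w, A.fromTop.onV (C.equiv (k, v)) = A.fromTop.onV (C.equiv (l, w)) ↔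
      χ k = χ l ∧ v = w := by
    intro k l v w
    refine ⟨fun h => ?_, fun ⟨h, h'⟩ => h' ▸ (hA k l v).2 h⟩
    have hvw : v = w := by rw [← hbase k v, h, hbase]
    subst hvw
    exact ⟨(hA k l v).1 h, rfl⟩
  let e : Bool × V ≃ A.V₁ := Equiv.ofBijective
    (fun x => A.fromTop.onV (C.equiv (g x.1, x.2))) (by
      refine ⟨fun x y h => ?_, fun z => ?_⟩
      · have := (hAA _ _ _ _).1 h
        rw [hg, hg] at this
        exact Prod.ext this.1 this.2
      · obtain ⟨w, rfl⟩ := A.fromTop_covering.onV_surjective A.connected z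
        obtain ⟨⟨k, v⟩, rfl⟩ := C.equiv.surjective w
        exact ⟨(χ k, v), (hA _ _ _).2 (hg _)⟩)
  have he : ∀ a v, e (a, v) = A.fromTop.onV (C.equiv (g a, v)) := fun _ _ => rfl
  let N : Bool → Matrix V V ℚ := fun a => ∑ k with χ k = a, C.block k
  have hlap : ∀ a b v w, A.graph.lap (e (a, v)) (e (b, w)) = N (a ^^ b) v w := by
    intro a b v w
    rw [he a v, ← A.fromTop_covering.sum_lap, Finset.sum_filter, ← C.equiv.sum_comp,
      Fintype.sum_prod_type]
    simp only [he, hAA, hg, C.lap_equiv, N, Matrix.sum_apply, Finset.sum_filter]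
    -- Translation by `g a` turns the sum over target sheets into a sum over differences of sheets.
    have hinv : Function.Involutive
        fun k : Bool × Bool => ((g a).1 ^^ k.1, (g a).2 ^^ k.2) := fun k => by simp
    rw [← Equiv.sum_comp hinv.toPerm]
    refine Finset.sum_congr rfl fun k _ => ?_
    rw [hinv.coe_toPerm, hχ, hg]
    by_cases h : (a ^^ χ k) = b
    · have h' : χ k = (a ^^ b) := by rw [← h]; simp
      simp [h']
    · have h' : χ k ≠ (a ^^ b) := fun h' => h (by rw [h']; simp)
      simp [h, h']
  have hcard : (Fintype.card A.V₁ : ℚ) = 2 * Fintype.card V := by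
    rw [← Fintype.card_congr e]
    simp
  have h1 := det_lap_add_const A.graph 1
  have h2 := det_lap_add_const X 2
  have h3 : (N false + of fun _ _ => 1) + (N true + of fun _ _ => 1) =
      X.lap + of fun _ _ => 2 := by
    have : X.lap = N false + N true := by
      rw [C.lap_base hπ, ← Finset.sum_filter_add_sum_filter_not _ (fun k => χ k = false)]
      simp [N]
    rw [this]
    ext v w
    simp
    ring
  rw [← det_reindex_self e.symm, det_circulant_bool (fun a => N a + of fun _ _ => 1), h3, h2,
    hcard, add_sub_add_right_eq_sub] at h1
  · have hn : (Fintype.card V : ℚ) ≠ 0 := by simp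
    refine mul_left_cancel₀ (mul_ne_zero two_ne_zero (pow_ne_zero 2 hn)) ?_
    linear_combination -h1
  · intro a b v w
    simp [hlap]

end KleinCoordinates

end

end Multigraph

/-! ### Assembling the formula -/

open Multigraph in
theorem mainTheorem6 {V' D' V D : Type*} [Finite V'] [Finite D'] [Finite V] [Finite D]
    (Y : Multigraph V' D') (X : Multigraph V D)
    (hY : Y.IsConnected) (hX : X.IsConnected)
    (π : Multigraph.Hom Y X) (hπ : π.IsGalois)
    (hG : Nonempty (π.deck ≃* Multiplicative (ZMod 2 × ZMod 2)))
    (X₂ X₃ X₄ : Multigraph.IntermediateDoubleCover π)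
    (h₂₃ : ¬ X₂.Equivalent X₃) (h₂₄ : ¬ X₂.Equivalent X₄) (h₃₄ : ¬ X₃.Equivalent X₄) :
    (Y.kappa : ℚ) =
      2 * ((X₂.graph.kappa * X₃.graph.kappa * X₄.graph.kappa : ℚ) / (X.kappa : ℚ) ^ 2) := by
  classical
  let _ := Fintype.ofFinite V'
  let _ := Fintype.ofFinite D'
  let _ := Fintype.ofFinite V
  let _ := Fintype.ofFinite D
  have : Nonempty V' := hY.1
  have : Nonempty V := hX.1
  obtain ⟨θ, hθ, hθmul, h0, h1, h2⟩ := exists_klein_four_coordinates hG.some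
    ![X₂.character, X₃.character, X₄.character]
    (by
      intro i
      fin_cases i
      exacts [IntermediateDoubleCover.character_mul hY, IntermediateDoubleCover.character_mul hY,
        IntermediateDoubleCover.character_mul hY])
    (by
      intro i
      fin_cases i
      exacts [IntermediateDoubleCover.exists_character_eq_true hY hπ,
        IntermediateDoubleCover.exists_character_eq_true hY hπ,
        IntermediateDoubleCover.exists_character_eq_true hY hπ])
    (by
      have e₂₃ := mt (IntermediateDoubleCover.equivalent_of_character_eq hY hπ) h₂₃
      have e₂₄ := mt (IntermediateDoubleCover.equivalent_of_character_eq hY hπ) h₂₄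
      have e₃₄ := mt (IntermediateDoubleCover.equivalent_of_character_eq hY hπ) h₃₄
      intro i j h
      fin_cases i <;> fin_cases j <;>
        first | rfl | exact absurd h ‹_› | exact absurd h.symm ‹_›)
  -- A section on vertices only; its translates under the deck group are the sheets.
  obtain ⟨s, hs⟩ := (hπ.1.onV_surjective hX).hasRightInverse
  have hθθ : ∀ k, θ k * θ k = 1 := by
    intro k
    have hff := hθmul (false, false) (false, false)
    rw [← hθmul]
    simpa using hff
  have hbase : ∀ k v, π.onV ((θ k).1.1 (s v)) = v := fun k v => by rw [Hom.onV_deck, hs]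
  let C : KleinCoordinates π :=
    { equiv := Equiv.ofBijective (fun x => (θ x.1).1.1 (s x.2)) (by
        refine ⟨fun x y h => ?_, fun w => ?_⟩
        · dsimp only at h
          have hv : x.2 = y.2 := by rw [← hbase x.1 x.2, h, hbase]
          rw [hv] at h
          exact Prod.ext (hθ.1 (hπ.1.deck_ext hY h)) hv
        · obtain ⟨σ, hσ, hw⟩ := hπ.2 (s (π.onV w)) w (hs _)
          obtain ⟨k, hk⟩ := hθ.2 ⟨σ, hσ⟩
          refine ⟨(k, π.onV w), ?_⟩
          dsimp only
          rw [hk, hw])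
      block := fun k v w => Y.lap (s v) ((θ k).1.1 (s w))
      onV_equiv := hbase
      lap_equiv := fun k l v w => by
        -- Applying the involution `θ k` moves the first vertex from the sheet `s` to the sheet of
        -- `k`, and the second to that of `l`.
        rw [hθmul, ← Hom.lap_deck (θ k) (s v)]
        change _ = Y.lap _ ((θ k * (θ k * θ l)).1.1 (s w))
        rw [← mul_assoc, hθθ, one_mul]
        rfl }
  have k2 := C.kappa_intermediate hπ.1 X₂ (fun k => k.1) (fun a => (a, false)) (by simp) (by simp)
    (fun k l v => by
      rw [← h0 k, ← h0 l]
      exact IntermediateDoubleCover.fromTop_deck_eq_deck_iff hY _ _ _)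
  have k3 := C.kappa_intermediate hπ.1 X₃ (fun k => k.2) (fun a => (false, a)) (by simp) (by simp)
    (fun k l v => by
      rw [← h1 k, ← h1 l]
      exact IntermediateDoubleCover.fromTop_deck_eq_deck_iff hY _ _ _)
  have k4 := C.kappa_intermediate hπ.1 X₄ (fun k => k.1 ^^ k.2) (fun a => (a, false)) (by decide)
    (by simp) (fun k l v => by
      rw [← h2 k, ← h2 l]
      exact IntermediateDoubleCover.fromTop_deck_eq_deck_iff hY _ _ _)
  have kY := C.kappa_top hπ.1
  simp only [Finset.sum_filter, Fintype.sum_prod_type, Fintype.sum_bool, Bool.true_xor,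
    Bool.false_xor, Bool.not_true, Bool.not_false, reduceIte, reduceCtorEq, add_zero,
    zero_add] at k2 k3 k4
  rw [add_comm (C.block (false, true)), add_comm (C.block (true, true))] at k2
  rw [add_comm (C.block (true, false)), add_comm (C.block (true, true))] at k3
  rw [add_comm (C.block (true, true))] at k4
  have hpos : (X.kappa : ℚ) ≠ 0 := by exact_mod_cast hX.kappa_pos.ne'
  rw [mul_div_assoc', eq_div_iff (pow_ne_zero 2 hpos)]
  generalize (C.block (false, false) + C.block (false, true) -
    (C.block (true, false) + C.block (true, true))).det = d₂ at k2 kY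
  generalize (C.block (false, false) + C.block (true, false) -
    (C.block (false, true) + C.block (true, true))).det = d₃ at k3 kY
  generalize (C.block (false, false) + C.block (true, true) -
    (C.block (true, false) + C.block (false, true))).det = d₄ at k4 kY
  -- Replacing each `2 κ_{X_i}` by `κ_X d_i` in turn gives `8 κ_{X₂} κ_{X₃} κ_{X₄} = κ_X³ d₂ d₃ d₄ =
  -- 4 κ_X² κ_Y`.
  linear_combination (X.kappa : ℚ) ^ 2 / 4 * kY -
    1 / 4 * (4 * X₃.graph.kappa * X₄.graph.kappa * k2 +
    2 * X.kappa * d₂ * X₄.graph.kappa * k3 + X.kappa * d₂ * X.kappa * d₃ * k4)
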